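/- Let $K$ be a field of characteristic zero and let $D$ be a finite set. Let $T_P^D$ be the set of planar rooted trees whose vertices are decorated by elements of $D$, and write $B_d(t_1\ldots t_n)$ for the tree obtained by grafting $t_1,\ldots,t_n\in T_P^D$, in this order from left to right, on a common root decorated by $d\in D$. Let $Br(D)=K\,T_P^D$ be the $K$-vector space with basis $T_P^D$, graded by the number of vertices, with the bilinear product $\star$ determined by $$t\star B_d(t_1\ldots t_n)=\sum_{i=0}^{n}B_d(t_1\ldots t_i\,t\,t_{i+1}\ldots t_n)\qquad(t,t_1,\ldots,t_n\in T_P^D,\ d\in D).$$ A (left) non-associative permutative algebra is a $K$-vector space with a bilinear product satisfying $x\star(y\star z)=y\star(x\star z)$ for all $x,y,z$. Then $(Br(D),\star)$ is a free non-associative permutative algebra. More precisely, the subspace $Br(D)\star Br(D)$ spanned by all products has a graded complement in $Br(D)$; and every graded complement $V$ of it generates $(Br(D),\star)$, and $(Br(D),\star)$ is the free non-associative permutative algebra on any basis $(v_i)_{i\in I}$ of $V$, that is, for every non-associative permutative algebra $A$ over $K$ and every map $f:I\to A$ there is exactly one morphism of non-associative permutative algebras $\varphi:Br(D)\to A$ with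 $\varphi(v_i)=f(i)$ for all $i\in I$. -/

import Mathlib

universe u v w z t

namespace BraceNAP

/-- Planar rooted trees whose vertices are decorated by `D`. The tree `node d [t₁, …, tₙ]` is
`B_d(t₁ … tₙ)`: the trees `t₁, …, tₙ` grafted, in this order from left to right, on a common root
decorated by `d`. -/
inductive PlanarTree (D : Type v) : Type v
  | node : D → List (PlanarTree D) → PlanarTree D

namespace PlanarTree

variable {D : Type v}

mutual
/-- The weight of a tree: its number of vertices. -/
def weight : PlanarTree D → ℕ
  | node _ ts => 1 + forestWeight ts
/-- The total number of vertices of a planar forest. -/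
def forestWeight : List (PlanarTree D) → ℕ
  | [] => 0
  | t :: ts => weight t + forestWeight ts
end

end PlanarTree

/-- `Br(D) = K T_P^D`: the `K`-vector space with basis the set of planar rooted trees decorated
by `D`. -/
abbrev Br (K : Type u) (D : Type v) [Field K] : Type (max u v) := PlanarTree D →₀ K

section NAP

variable {K : Type u} [Field K] {A : Type w} [AddCommGroup A] [Module K A]

/-- A bilinear product on a vector space is (left) non-associative permutative if
`x ⋆ (y ⋆ z) = y ⋆ (x ⋆ z)` for all `x, y, z`. -/
def IsNAP (mul : A →ₗ[K] A →ₗ[K] A) : Prop :=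
  ∀ x y z : A, mul x (mul y z) = mul y (mul x z)

/-- The subspace `V` generates the algebra `(A, mul)`: the only subspace of `A` that contains `V`
and is closed under the product is `A` itself. -/
def Generates (mul : A →ₗ[K] A →ₗ[K] A) (V : Submodule K A) : Prop :=
  ∀ S : Submodule K A, V ≤ S → (∀ x ∈ S, ∀ y ∈ S, mul x y ∈ S) → S = ⊤

/-- `(A, mul)` is the free non-associative permutative algebra on the family `(gᵢ)`: it is a
non-associative permutative algebra, and for every non-associative permutative algebra
`(B, mulB)` over `K`, every map from the index set to `B` extends along `(gᵢ)` to exactly one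
morphism of algebras from `A` to `B`. -/
def IsFreeNAPOn (mul : A →ₗ[K] A →ₗ[K] A) {ι : Type z} (g : ι → A) : Prop :=
  IsNAP mul ∧
    ∀ (B : Type t) [AddCommGroup B] [Module K B] (mulB : B →ₗ[K] B →ₗ[K] B), IsNAP mulB →
      ∀ f : ι → B, ∃! φ : A →ₗ[K] B,
        (∀ x y : A, φ (mul x y) = mulB (φ x) (φ y)) ∧ ∀ i, φ (g i) = f i

end NAP

section Star

variable (K : Type u) [Field K] (D : Type v)

/-- The product of two trees,
`t ⋆ B_d(t₁ … tₙ) = ∑_{i=0}^{n} B_d(t₁ … tᵢ t tᵢ₊₁ … tₙ)`. -/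
noncomputable def starTree (t : PlanarTree D) : PlanarTree D → Br K D
  | .node d ts => ∑ i ∈ Finset.range (ts.length + 1),
      Finsupp.single (.node d (ts.take i ++ t :: ts.drop i)) 1

/-- The bilinear extension of the product of trees to `Br(D)`. -/
noncomputable def starProd : Br K D →ₗ[K] Br K D →ₗ[K] Br K D :=
  Finsupp.linearCombination K fun t => Finsupp.linearCombination K fun t' => starTree K D t t'

variable {K D}

/-- A subspace of `Br(D)` is graded, for the grading by the number of vertices, if it contains the
homogeneous components of each of its elements. -/
def IsGraded (V : Submodule K (Br K D)) : Prop :=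
  ∀ x ∈ V, ∀ n : ℕ, x.filter (fun t => t.weight = n) ∈ V

/-- `V` is a graded complement in `Br(D)` of `Br(D) ⋆ Br(D)`, the span of all the products. -/
def IsGradedComplement (V : Submodule K (Br K D)) : Prop :=
  IsGraded V ∧ IsCompl (Submodule.map₂ (starProd K D) ⊤ ⊤) V

end Star

end BraceNAP

namespace BraceNAP

-- Generation is an induction on weight: modulo `V`, a homogeneous element is a combination of
-- products of lighter trees. For freeness, a linear map on `V` is extended weight by weight; the
-- obstruction is that every linear relation between products of trees must also hold between the
-- products of their images.
--
-- For a fixed root decoration, multiplying by `t` shuffles the letter `t` into the word of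
-- subtrees. So it suffices that all relations between such shuffles follow from their commutation,
-- which is the NAP identity. `exists_sum_permutations'Aux_eq` proves this by leading words: for a
-- well-order on the letters, the insertions of `t` into a word have a largest result, whose
-- multiplicity is invertible in characteristic zero. By `exists_of_maxInsert_eq`, two insertions of
-- different letters with the same leading word come from one commutation. `exists_map_starProd_eq`
-- turns this into the extension step, and `exists_lift` glues the steps.

theorem cons_mem_permutations'Aux {α : Type*} (t : α) (w : List α) : t :: w ∈ w.permutations'Aux t := by
  cases w <;> simp

theorem length_of_mem_permutations'Aux {α : Type*} {t : α} {w u : List α} (h : u ∈ w.permutations'Aux t) :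
    u.length = w.length + 1 := by
  induction w generalizing u with
  | nil => simp_all
  | cons a w ih =>
    simp only [List.permutations'Aux, List.mem_cons, List.mem_map] at h
    obtain rfl | ⟨v, hv, rfl⟩ := h
    · simp
    · simp [ih hv]

-- Leading words of letter insertions.

section Words

variable {α : Type*} [LinearOrder α]

/-- The largest word obtained by inserting the letter `t` into a word: `t` is put in front of the
first letter that is smaller. -/
def maxInsert (t : α) (w : List α) : List α :=
  w.orderedInsert (· > ·) t

theorem maxInsert_nil (t : α) : maxInsert t [] = [t] := rfl

theorem maxInsert_cons_of_lt {t a : α} (w : List α) (h : a < t) :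
    maxInsert t (a :: w) = t :: a :: w := by
  simp [maxInsert, h]

theorem maxInsert_cons_of_le {t a : α} (w : List α) (h : t ≤ a) :
    maxInsert t (a :: w) = a :: maxInsert t w := by
  simp [maxInsert, not_lt.2 h]

theorem length_maxInsert (t : α) (w : List α) : (maxInsert t w).length = w.length + 1 :=
  List.orderedInsert_length ..

theorem shortlex_cons_of_lt {a b : α} {x y : List α} (hl : x.length = y.length) (h : a < b) :
    List.Shortlex (· < ·) (a :: x) (b :: y) :=
  .of_lex (by simp [hl]) (.rel h)

/-- Among the insertions of `t` into `w`, `maxInsert t w` occurs, and the others are smaller. -/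
theorem permutations'Aux_perm (t : α) (w : List α) : ∃ (k : ℕ) (l : List (List α)),
    (w.permutations'Aux t).Perm (List.replicate (k + 1) (maxInsert t w) ++ l) ∧
      ∀ v ∈ l, List.Shortlex (· < ·) v (maxInsert t w) := by
  induction w with
  | nil => exact ⟨0, [], by simp [maxInsert_nil], by simp⟩
  | cons a w ih =>
    obtain hat | hta := lt_or_ge a t
    · rw [maxInsert_cons_of_lt w hat]
      refine ⟨0, (w.permutations'Aux t).map (List.cons a), by simp, ?_⟩
      simp only [List.mem_map, forall_exists_index, and_imp]
      rintro _ v hv rfl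
      exact shortlex_cons_of_lt (by simpa using length_of_mem_permutations'Aux hv) hat
    · obtain ⟨k, l, hp, hl⟩ := ih
      rw [maxInsert_cons_of_le w hta]
      have hp' := hp.map (List.cons a)
      rw [List.map_append, List.map_replicate] at hp'
      have hl' : ∀ v ∈ l.map (List.cons a),
          List.Shortlex (· < ·) v (a :: maxInsert t w) := by
        simp only [List.mem_map, forall_exists_index, and_imp]
        rintro _ v hv rfl
        exact (hl v hv).cons
      -- If `t = a`, deleting the common first letter leaves `t :: w`, itself one of the insertions
      -- of `t` into `w`.
      have key : t :: a :: w = a :: maxInsert t w ∨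
          List.Shortlex (· < ·) (t :: a :: w) (a :: maxInsert t w) := by
        obtain h | rfl := hta.lt_or_eq
        · exact .inr (shortlex_cons_of_lt (by simp [length_maxInsert]) h)
        · have := hp.mem_iff.1 (cons_mem_permutations'Aux t w)
          rw [List.mem_append] at this
          obtain h | h := this
          · exact .inl (by rw [← List.eq_of_mem_replicate h])
          · exact .inr (hl _ h).cons
      obtain h | h := key
      · refine ⟨k + 1, l.map (List.cons a), ?_, hl'⟩
        rw [List.permutations'Aux, h, List.replicate_succ, List.cons_append]
        exact hp'.cons _
      · refine ⟨k, (t :: a :: w) :: l.map (List.cons a), ?_, ?_⟩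
        · exact (hp'.cons _).trans List.perm_middle.symm
        · simpa [h] using hl'

/-- Monotonicity keeps smaller words smaller under a further insertion, so induction on leading
words applies to double insertions. -/
theorem maxInsert_strictMono (t : α) {v w : List α} (h : List.Shortlex (· < ·) v w) :
    List.Shortlex (· < ·) (maxInsert t v) (maxInsert t w) := by
  rw [List.shortlex_def] at h
  obtain h | ⟨hl, h⟩ := h
  · exact .of_length_lt (by simpa [length_maxInsert] using h)
  induction h with
  | nil => simp at hl
  | @cons a x y h ih =>
    have hl' : x.length = y.length := by simpa using hl
    obtain hat | hta := lt_or_ge a t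
    · rw [maxInsert_cons_of_lt _ hat, maxInsert_cons_of_lt _ hat]
      exact (List.Shortlex.of_lex hl' h).cons.cons
    · rw [maxInsert_cons_of_le _ hta, maxInsert_cons_of_le _ hta]
      exact (ih hl').cons
  | @rel a x b y h =>
    have hl' : x.length = y.length := by simpa using hl
    obtain hat | hta := lt_or_ge a t
    · rw [maxInsert_cons_of_lt _ hat]
      obtain hbt | htb := lt_or_ge b t
      · rw [maxInsert_cons_of_lt _ hbt]
        exact (shortlex_cons_of_lt hl' h).cons
      · rw [maxInsert_cons_of_le _ htb]
        obtain h' | rfl := htb.lt_or_eq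
        · exact shortlex_cons_of_lt (by simp [length_maxInsert, hl']) h'
        -- Both words start with `t`; next comes `a < t` on the left and a letter at least `t` on
        -- the right.
        · apply List.Shortlex.cons
          cases y with
          | nil => exact shortlex_cons_of_lt (by simpa using hl') hat
          | cons c y =>
            obtain hct | htc := lt_or_ge c t
            · rw [maxInsert_cons_of_lt _ hct]
              exact shortlex_cons_of_lt (by simpa using hl') hat
            · rw [maxInsert_cons_of_le _ htc]
              exact shortlex_cons_of_lt (by simpa [length_maxInsert] using hl') (hat.trans_le htc)
    · rw [maxInsert_cons_of_le _ hta, maxInsert_cons_of_le _ (hta.trans h.le)]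
      exact shortlex_cons_of_lt (by simp [length_maxInsert, hl']) h

theorem maxInsert_injective [WellFoundedLT α] (t : α) :
    Function.Injective (maxInsert t : List α → List α) := by
  intro v w h
  by_contra hne
  have : Std.Irrefl (List.Shortlex (α := α) (· < ·)) := (List.Shortlex.wf wellFounded_lt).irrefl
  obtain h' | h' := Std.Trichotomous.rel_or_eq_or_rel_swap (r := List.Shortlex (α := α) (· < ·))
    (a := v) (b := w) |>.imp_right (Or.resolve_left · hne)
  · have := maxInsert_strictMono t h'
    rw [h] at this
    exact irrefl _ this
  · have := maxInsert_strictMono t h'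
    rw [h] at this
    exact irrefl _ this

/-- The first letter of `y`, if any, is either below `s` or also the first letter of `x`; both ways
it is below `t`. -/
theorem eq_maxInsert_of_lt_of_cons_eq {s t : α} (hst : s < t) {x y : List α}
    (h : t :: x = t :: maxInsert s y) (hx : ∀ a ∈ x.head?, a < t) : maxInsert t y = t :: y := by
  obtain rfl : x = maxInsert s y := by simpa using h
  cases y with
  | nil => rfl
  | cons c y =>
    refine maxInsert_cons_of_lt y ?_
    obtain hcs | hsc := lt_or_ge c s
    · exact hcs.trans hst
    · exact hx c (by simp [maxInsert_cons_of_le y hsc])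

/-- Insertions of two different letters with a common result both factor through an insertion into
the same word. -/
theorem exists_of_maxInsert_eq {s t : α} (hst : s ≠ t) {x y : List α}
    (h : maxInsert t x = maxInsert s y) : ∃ z, x = maxInsert s z ∧ y = maxInsert t z := by
  induction x generalizing y with
  | nil =>
    cases y with
    | nil => simp [maxInsert_nil, hst.symm] at h
    | cons b y => simpa [maxInsert_nil, length_maxInsert] using congrArg List.length h
  | cons a x ih =>
    cases y with
    | nil => simpa [maxInsert_nil, length_maxInsert] using congrArg List.length h
    | cons b y =>
      obtain hat | hta := lt_or_ge a t <;> obtain hbs | hsb := lt_or_ge b s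
      · rw [maxInsert_cons_of_lt x hat, maxInsert_cons_of_lt y hbs] at h
        simp [hst.symm] at h
      · rw [maxInsert_cons_of_lt x hat, maxInsert_cons_of_le y hsb] at h
        obtain rfl : t = b := by simp_all
        exact ⟨y, by simpa using h,
          (eq_maxInsert_of_lt_of_cons_eq (hsb.lt_of_ne hst) h (by simpa using hat)).symm⟩
      · rw [maxInsert_cons_of_le x hta, maxInsert_cons_of_lt y hbs] at h
        obtain rfl : a = s := by simp_all
        exact ⟨x, (eq_maxInsert_of_lt_of_cons_eq (hta.lt_of_ne hst.symm) h.symm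
          (by simpa using hbs)).symm, by simpa using h.symm⟩
      · rw [maxInsert_cons_of_le x hta, maxInsert_cons_of_le y hsb, List.cons.injEq] at h
        obtain ⟨rfl, h⟩ := h
        obtain ⟨z, rfl, rfl⟩ := ih h
        exact ⟨a :: z, by rw [maxInsert_cons_of_le _ hsb], by rw [maxInsert_cons_of_le _ hta]⟩

end Words

-- Relations between shuffles with letters.

section Extension

variable {B : Type*} [AddCommGroup B]

theorem sum_map_permutations'Aux_comm {α : Type*} (ψ : List α → B) (s t : α) (w : List α) :
    ((w.permutations'Aux s).map fun v => ((v.permutations'Aux t).map ψ).sum).sum =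
      ((w.permutations'Aux t).map fun v => ((v.permutations'Aux s).map ψ).sum).sum := by
  have := ((List.perm_permutations'Aux_comm s t w).map ψ).sum_eq
  simpa only [List.map_flatMap, List.flatMap_def, List.map_flatten, List.sum_flatten, List.map_map,
    Function.comp_def] using this

/-- A family `β t w`, compatible with the commutation of insertions, is given by the sum over the
insertions of `t` into `w` of some function on words: the relations expressing that the
operators of shuffling with a letter commute generate all the relations between them. -/
theorem exists_sum_permutations'Aux_eq {α : Type*} (K : Type*) [Field K] [CharZero K]
    [Module K B] (β : α → List α → B)
    (hβ : ∀ (s t : α) (w : List α), ((w.permutations'Aux s).map (β t)).sum =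
      ((w.permutations'Aux t).map (β s)).sum) :
    ∃ ψ : List α → B, ∀ t w, ((w.permutations'Aux t).map ψ).sum = β t w := by
  classical
  obtain ⟨_, _⟩ := exists_wellFoundedLT α
  choose k l hperm hlt using permutations'Aux_perm (α := α)
  have hsum : ∀ (f : List α → B) t w, ((w.permutations'Aux t).map f).sum =
      (k t w + 1) • f (maxInsert t w) + ((l t w).map f).sum := by
    intro f t w
    rw [((hperm t w).map f).sum_eq]
    simp
  have hwf : WellFounded (List.Shortlex (α := α) (· < ·)) := List.Shortlex.wf wellFounded_lt
  -- The equation of one chosen insertion with leading word `u` is solved for the value at `u`; its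
  -- other words are smaller, so the inner default `0` is never reached. The outer `0` is an
  -- arbitrary choice.
  let F : (u : List α) → ((v : List α) → List.Shortlex (· < ·) v u → B) → B := fun u g =>
    if h : ∃ p : α × List α, maxInsert p.1 p.2 = u then
      ((k h.choose.1 h.choose.2 + 1 : ℕ) : K)⁻¹ • (β h.choose.1 h.choose.2 -
        ((l h.choose.1 h.choose.2).map fun v =>
          if hv : List.Shortlex (· < ·) v u then g v hv else 0).sum)
    else 0
  let ψ := hwf.fix F
  have hψ : ∀ u, (∃ p : α × List α, maxInsert p.1 p.2 = u) → ∃ p : α × List α,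
      maxInsert p.1 p.2 = u ∧ ((p.2.permutations'Aux p.1).map ψ).sum = β p.1 p.2 := by
    intro u h
    refine ⟨h.choose, h.choose_spec, ?_⟩
    have h0 : ((k h.choose.1 h.choose.2 + 1 : ℕ) : K) ≠ 0 := Nat.cast_ne_zero.2 (Nat.succ_ne_zero _)
    have h1 : ψ u = ((k h.choose.1 h.choose.2 + 1 : ℕ) : K)⁻¹ • (β h.choose.1 h.choose.2 -
        ((l h.choose.1 h.choose.2).map ψ).sum) := by
      change hwf.fix F u = _
      rw [hwf.fix_eq]
      simp only [F, dif_pos h]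
      congr 3
      refine List.map_congr_left fun v hv => ?_
      have := hlt _ _ v hv
      rw [h.choose_spec] at this
      rw [dif_pos this]
    rw [hsum, h.choose_spec, h1, ← Nat.cast_smul_eq_nsmul K, smul_inv_smul₀ h0]
    abel
  refine ⟨ψ, fun s y => ?_⟩
  induction hu : maxInsert s y using hwf.induction generalizing s y with
  | _ u ih =>
  obtain ⟨⟨t, x⟩, hx, hsol⟩ := hψ u ⟨(s, y), hu⟩
  dsimp only at hx hsol
  obtain rfl | hst := eq_or_ne s t
  · obtain rfl := maxInsert_injective s (hx.trans hu.symm)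
    exact hsol
  -- In the two orders of inserting `s` and `t` into `z`, every equation but the one for `s` and
  -- `maxInsert t z` is known, by induction or by the choice of `(t, x)`. Comparison gives the
  -- missing one up to a nonzero integer factor.
  obtain ⟨z, rfl, rfl⟩ := exists_of_maxInsert_eq hst (hx.trans hu.symm)
  have h1 := hβ s t z
  have h2 := sum_map_permutations'Aux_comm ψ s t z
  rw [hsum, hsum (β s)] at h1
  rw [hsum, hsum _ t z, hsol] at h2
  have e1 : (l s z).map (fun v => ((v.permutations'Aux t).map ψ).sum) = (l s z).map (β t) := by
    refine List.map_congr_left fun v hv => ih _ ?_ t v rfl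
    rw [← hx]
    exact maxInsert_strictMono t (hlt s z v hv)
  have e2 : (l t z).map (fun v => ((v.permutations'Aux s).map ψ).sum) = (l t z).map (β s) := by
    refine List.map_congr_left fun v hv => ih _ ?_ s v rfl
    rw [← hu]
    exact maxInsert_strictMono s (hlt t z v hv)
  rw [e1, e2, h1] at h2
  have h3 := add_right_cancel h2
  rw [← Nat.cast_smul_eq_nsmul K, ← Nat.cast_smul_eq_nsmul K] at h3
  exact (smul_right_injective B
    (Nat.cast_ne_zero.2 (Nat.succ_ne_zero _) : ((k t z + 1 : ℕ) : K) ≠ 0) h3).symm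

end Extension

-- Weights of trees and forests.

namespace PlanarTree

variable {D : Type v}

theorem weight_node (d : D) (ts : List (PlanarTree D)) :
    weight (node d ts) = 1 + forestWeight ts := by
  rw [weight]

theorem weight_pos (t : PlanarTree D) : 0 < weight t := by
  cases t
  rw [weight_node]
  lia

theorem forestWeight_of_mem_permutations'Aux {t : PlanarTree D} {ts us : List (PlanarTree D)}
    (h : us ∈ ts.permutations'Aux t) : forestWeight us = weight t + forestWeight ts := by
  induction ts generalizing us with
  | nil => simp_all [forestWeight]
  | cons a ts ih =>
    simp only [List.permutations'Aux, List.mem_cons, List.mem_map] at h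
    obtain rfl | ⟨vs, hvs, rfl⟩ := h
    · simp [forestWeight]
    · rw [forestWeight, forestWeight, ih hvs]
      lia

theorem weight_node_of_mem_permutations'Aux (d : D) {t : PlanarTree D}
    {ts us : List (PlanarTree D)} (h : us ∈ ts.permutations'Aux t) :
    weight (node d us) = weight t + weight (node d ts) := by
  rw [weight_node, weight_node, forestWeight_of_mem_permutations'Aux h]
  lia

end PlanarTree

open PlanarTree

-- The product as insertion into words, and the NAP identity.

section Star

variable {K : Type u} [Field K] {D : Type v}

theorem starTree_node (t : PlanarTree D) (d : D) (ts : List (PlanarTree D)) :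
    starTree K D t (.node d ts) =
      ((ts.permutations'Aux t).map fun us => Finsupp.single (PlanarTree.node d us) (1 : K)).sum := by
  have key : ∀ (g : List (PlanarTree D) → Br K D),
      ∑ i ∈ Finset.range (ts.length + 1), g (ts.take i ++ t :: ts.drop i) =
        ((ts.permutations'Aux t).map g).sum := by
    induction ts with
    | nil => simp
    | cons a ts ih =>
      intro g
      rw [List.length_cons, Finset.sum_range_succ', add_comm]
      simpa [Function.comp_def] using ih fun us => g (a :: us)
  exact key fun us => Finsupp.single (PlanarTree.node d us) (1 : K)

theorem starProd_single (t s : PlanarTree D) :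
    starProd K D (.single t 1) (.single s 1) = starTree K D t s := by
  simp [starProd]

theorem map_starProd_single {B : Type*} [AddCommGroup B] [Module K B] (φ : Br K D →ₗ[K] B)
    (t : PlanarTree D) (d : D) (ts : List (PlanarTree D)) :
    φ (starProd K D (.single t 1) (.single (.node d ts) 1)) =
      ((ts.permutations'Aux t).map fun us => φ (.single (.node d us) 1)).sum := by
  rw [starProd_single, starTree_node, map_list_sum, List.map_map]
  rfl

theorem map_starProd_eq_of_single {B : Type*} [AddCommGroup B] [Module K B]
    (φ : Br K D →ₗ[K] B) (mulB : B →ₗ[K] B →ₗ[K] B)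
    (h : ∀ t s, φ (starProd K D (.single t 1) (.single s 1)) =
      mulB (φ (.single t 1)) (φ (.single s 1))) (x y : Br K D) :
    φ (starProd K D x y) = mulB (φ x) (φ y) := by
  have : (starProd K D).compr₂ φ = mulB.compl₁₂ φ φ := by
    ext t s
    simpa using h t s
  simpa using LinearMap.congr_fun₂ this x y

theorem isNAP_starProd : IsNAP (starProd K D) := by
  have single : ∀ t s r : PlanarTree D,
      starProd K D (.single t 1) (starProd K D (.single s 1) (.single r 1)) =
        starProd K D (.single s 1) (starProd K D (.single t 1) (.single r 1)) := by
    rintro t s ⟨d, ts⟩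
    rw [map_starProd_single, map_starProd_single]
    simp only [starProd_single, starTree_node]
    exact sum_map_permutations'Aux_comm _ s t ts
  intro x y z
  induction x using Finsupp.induction_linear with
  | zero => simp
  | add x x' hx hx' => simp [hx, hx']
  | single t a =>
    induction y using Finsupp.induction_linear with
    | zero => simp
    | add y y' hy hy' => simp [hy, hy']
    | single s b =>
      induction z using Finsupp.induction_linear with
      | zero => simp
      | add z z' hz hz' => simp [hz, hz']
      | single r c =>
        rw [← mul_one a, ← mul_one b, ← mul_one c]
        simp only [← smul_eq_mul, ← Finsupp.smul_single, map_smul, LinearMap.smul_apply, single,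
          smul_comm a b]

-- The weight grading, graded complements and generation.

variable (K D) in
/-- The projection of `Br(D)` on its homogeneous component of weight `n`. -/
noncomputable def homogComponent (n : ℕ) : Br K D →ₗ[K] Br K D where
  toFun x := x.filter fun t => t.weight = n
  map_add' _ _ := Finsupp.filter_add
  map_smul' _ _ := Finsupp.filter_smul

theorem homogComponent_single (n : ℕ) (t : PlanarTree D) (a : K) :
    homogComponent K D n (.single t a) = if t.weight = n then .single t a else 0 := by
  split_ifs with h
  · exact Finsupp.filter_single_of_pos _ h
  · exact Finsupp.filter_single_of_neg _ h

theorem homogComponent_homogComponent (m n : ℕ) (x : Br K D) :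
    homogComponent K D m (homogComponent K D n x) =
      if n = m then homogComponent K D n x else 0 := by
  ext t
  split_ifs with h
  all_goals
    simp only [homogComponent, LinearMap.coe_mk, AddHom.coe_mk, Finsupp.filter_apply,
      Finsupp.coe_zero, Pi.zero_apply]
    split_ifs <;> simp_all

theorem homogComponent_starProd_single (n : ℕ) (t s : PlanarTree D) :
    homogComponent K D n (starProd K D (.single t 1) (.single s 1)) =
      if t.weight + s.weight = n then starProd K D (.single t 1) (.single s 1) else 0 := by
  obtain ⟨d, ts⟩ := s
  rw [map_starProd_single]
  split_ifs with h
  · rw [starProd_single, starTree_node]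
    congr 1
    refine List.map_congr_left fun us hus => ?_
    rw [homogComponent_single, if_pos (by rw [weight_node_of_mem_permutations'Aux d hus, h])]
  · refine List.sum_eq_zero ?_
    simp only [List.mem_map, forall_exists_index, and_imp]
    rintro _ us hus rfl
    rw [homogComponent_single, if_neg (by rwa [weight_node_of_mem_permutations'Aux d hus])]

variable (K D) in
/-- The span of the products of two trees of total weight `n`. -/
noncomputable def productsOfWeight (n : ℕ) : Submodule K (Br K D) :=
  Submodule.span K {x | ∃ t s : PlanarTree D, t.weight + s.weight = n ∧
    starProd K D (.single t 1) (.single s 1) = x}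

theorem starProd_mem_products (x y : Br K D) :
    starProd K D x y ∈ Submodule.map₂ (starProd K D) ⊤ ⊤ :=
  Submodule.apply_mem_map₂ _ trivial trivial

theorem productsOfWeight_le (n : ℕ) :
    productsOfWeight K D n ≤ Submodule.map₂ (starProd K D) ⊤ ⊤ := by
  refine Submodule.span_le.2 ?_
  rintro _ ⟨t, s, -, rfl⟩
  exact starProd_mem_products _ _

theorem products_le {S : Submodule K (Br K D)}
    (h : ∀ t s, starProd K D (.single t 1) (.single s 1) ∈ S) :
    Submodule.map₂ (starProd K D) ⊤ ⊤ ≤ S := by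
  refine Submodule.map₂_le.2 fun x _ y _ => ?_
  clear * - h
  induction x using Finsupp.induction_linear with
  | zero => simp
  | add x x' hx hx' => simpa using S.add_mem hx hx'
  | single t a =>
    induction y using Finsupp.induction_linear with
    | zero => simp
    | add y y' hy hy' => simpa using S.add_mem hy hy'
    | single s b =>
      rw [← mul_one a, ← mul_one b]
      simp only [← smul_eq_mul, ← Finsupp.smul_single, map_smul, LinearMap.smul_apply]
      exact S.smul_mem _ (S.smul_mem _ (h t s))

theorem homogComponent_mem_productsOfWeight (n : ℕ) {x : Br K D}
    (hx : x ∈ Submodule.map₂ (starProd K D) ⊤ ⊤) :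
    homogComponent K D n x ∈ productsOfWeight K D n := by
  suffices Submodule.map₂ (starProd K D) ⊤ ⊤ ≤
    (productsOfWeight K D n).comap (homogComponent K D n) from this hx
  refine products_le fun t s => ?_
  rw [Submodule.mem_comap, homogComponent_starProd_single]
  split_ifs with h
  · exact Submodule.subset_span ⟨t, s, h, rfl⟩
  · exact zero_mem _

/-- An arbitrary projection `e` onto the products is made homogeneous: `g` keeps only the weight `n`
part of `e` on weight `n`. As the products form a graded subspace, `g` still projects onto them, and
its kernel is graded since `g` commutes with the components. -/
theorem exists_isGradedComplement : ∃ V : Submodule K (Br K D), IsGradedComplement V := by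
  set P := Submodule.map₂ (starProd K D) ⊤ ⊤
  obtain ⟨Q, hQ⟩ := Submodule.exists_isCompl P
  let e := P.projectionOnto Q hQ
  have heP : ∀ x (hx : x ∈ P), e x = ⟨x, hx⟩ := fun x hx =>
    Submodule.projectionOnto_apply_left hQ ⟨x, hx⟩
  let g : Br K D →ₗ[K] Br K D := Finsupp.linearCombination K fun t =>
    homogComponent K D t.weight (e (.single t 1))
  have hg : ∀ t, g (.single t 1) = homogComponent K D t.weight (e (.single t 1)) := by
    intro t
    simp [g]
  have hgP : ∀ x, g x ∈ P := by
    suffices LinearMap.range g ≤ P from fun x => this ⟨x, rfl⟩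
    rw [Finsupp.range_linearCombination, Submodule.span_le]
    rintro _ ⟨t, rfl⟩
    exact productsOfWeight_le _ (homogComponent_mem_productsOfWeight _ (e _).2)
  have hcomm : ∀ n x, g (homogComponent K D n x) = homogComponent K D n (g x) := by
    intro n x
    suffices g ∘ₗ homogComponent K D n = homogComponent K D n ∘ₗ g from LinearMap.congr_fun this x
    refine Finsupp.lhom_ext' fun t => LinearMap.ext_ring ?_
    simp only [LinearMap.comp_apply, Finsupp.lsingle_apply, homogComponent_single, hg,
      homogComponent_homogComponent]
    split_ifs <;> simp [hg]
  have hge : ∀ n x, g (homogComponent K D n x) =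
      homogComponent K D n (e (homogComponent K D n x)) := by
    intro n x
    suffices g ∘ₗ homogComponent K D n =
      homogComponent K D n ∘ₗ P.subtype ∘ₗ e ∘ₗ homogComponent K D n from LinearMap.congr_fun this x
    refine Finsupp.lhom_ext' fun t => LinearMap.ext_ring ?_
    simp only [LinearMap.comp_apply, Finsupp.lsingle_apply, homogComponent_single]
    split_ifs with h
    · rw [hg, h]
      rfl
    · simp
  have hfix : ∀ x ∈ P, g x = x := by
    suffices P ≤ LinearMap.eqLocus g LinearMap.id from fun x hx => this hx
    refine products_le fun t s => ?_
    have h := hge (t.weight + s.weight) (starProd K D (.single t 1) (.single s 1))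
    rw [homogComponent_starProd_single, if_pos rfl, heP _ (starProd_mem_products _ _)] at h
    rw [LinearMap.mem_eqLocus, h]
    exact (homogComponent_starProd_single ..).trans (if_pos rfl)
  refine ⟨LinearMap.ker g, fun x hx n => ?_, ?_⟩
  · change homogComponent K D n x ∈ _
    rw [LinearMap.mem_ker, hcomm, LinearMap.mem_ker.1 hx, map_zero]
  · rw [← LinearMap.ker_codRestrict P g hgP]
    exact LinearMap.isCompl_of_proj fun x => Subtype.ext (hfix x x.2)

/-- The bound `N` lets this apply to the equalizer of partial lifts, which are multiplicative only
up to some weight. -/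
theorem single_mem_of_isGradedComplement {V : Submodule K (Br K D)} (hV : IsGradedComplement V)
    {S : Submodule K (Br K D)} (hVS : V ≤ S) {N : ℕ}
    (hS : ∀ t s : PlanarTree D, t.weight + s.weight ≤ N → Finsupp.single t 1 ∈ S →
      Finsupp.single s 1 ∈ S → starProd K D (.single t 1) (.single s 1) ∈ S)
    (t : PlanarTree D) (ht : t.weight ≤ N) : Finsupp.single t 1 ∈ S := by
  induction hn : t.weight using Nat.strong_induction_on generalizing t with
  | _ n ih =>
  subst hn
  obtain ⟨p, hp, v, hv, h⟩ := Submodule.mem_sup.1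
    (hV.2.sup_eq_top.ge (Submodule.mem_top (x := Finsupp.single t (1 : K))))
  have h' := congrArg (homogComponent K D t.weight) h
  rw [homogComponent_single, if_pos rfl, map_add] at h'
  rw [← h']
  refine S.add_mem ?_ (hVS (hV.1 v hv _))
  suffices productsOfWeight K D t.weight ≤ S from this (homogComponent_mem_productsOfWeight _ hp)
  refine Submodule.span_le.2 ?_
  rintro _ ⟨r, s, hrs, rfl⟩
  have := r.weight_pos
  have := s.weight_pos
  exact hS r s (by lia) (ih _ (by lia) r (by lia) rfl) (ih _ (by lia) s (by lia) rfl)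

theorem generates_of_isGradedComplement {V : Submodule K (Br K D)} (hV : IsGradedComplement V) :
    Generates (starProd K D) V := by
  intro S hVS hS
  rw [eq_top_iff, ← (Finsupp.basisSingleOne (R := K) (ι := PlanarTree D)).span_eq,
    Submodule.span_le]
  rintro _ ⟨t, rfl⟩
  rw [Finsupp.coe_basisSingleOne]
  exact single_mem_of_isGradedComplement hV hVS (fun r s _ hr hs => hS _ hr _ hs) t le_rfl

end Star

-- Extension of linear maps on `V` to morphisms.

section Lift

variable {K : Type u} [Field K] [CharZero K] {D : Type v} {B : Type t} [AddCommGroup B]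
  [Module K B] {mulB : B →ₗ[K] B →ₗ[K] B}

/-- If `φ` is multiplicative up to weight `N`, the products of the images of trees of total weight
`N + 1` depend linearly on the products of these trees. -/
theorem exists_map_starProd_eq (hB : IsNAP mulB) {N : ℕ} (φ : Br K D →ₗ[K] B)
    (hφ : ∀ t s : PlanarTree D, t.weight + s.weight ≤ N →
      φ (starProd K D (.single t 1) (.single s 1)) = mulB (φ (.single t 1)) (φ (.single s 1))) :
    ∃ ψ : Br K D →ₗ[K] B, ∀ t s : PlanarTree D, t.weight + s.weight = N + 1 →
      ψ (starProd K D (.single t 1) (.single s 1)) = mulB (φ (.single t 1)) (φ (.single s 1)) := by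
  -- The cut-off by `0` isolates total weight `N + 1`; insertion adds weights, so it respects the
  -- compatibility condition.
  let β (d : D) (t : PlanarTree D) (w : List (PlanarTree D)) : B :=
    if t.weight + (node d w).weight = N + 1 then
      mulB (φ (.single t 1)) (φ (.single (node d w) 1)) else 0
  have hsum : ∀ d s t w, ((w.permutations'Aux s).map (β d t)).sum =
      if t.weight + s.weight + (node d w).weight = N + 1 then
        mulB (φ (.single t 1)) (mulB (φ (.single s 1)) (φ (.single (node d w) 1))) else 0 := by
    intro d s t w
    split_ifs with h
    · have := t.weight_pos
      -- Since `t` has positive weight, the inner product has weight at most `N`, where `φ` is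
      -- multiplicative.
      rw [← hφ s _ (by lia)]
      refine Eq.trans ?_ (map_starProd_single (mulB (φ (.single t 1)) ∘ₗ φ) s d w).symm
      congr 1
      refine List.map_congr_left fun us hus => if_pos ?_
      rw [weight_node_of_mem_permutations'Aux d hus, ← h, add_assoc]
    · refine List.sum_eq_zero ?_
      simp only [List.mem_map, forall_exists_index, and_imp]
      rintro _ us hus rfl
      refine if_neg ?_
      rwa [weight_node_of_mem_permutations'Aux d hus, ← add_assoc]
  choose ψ hψ using fun d => exists_sum_permutations'Aux_eq K (β d) fun s t w => by
    rw [hsum, hsum, hB, add_comm t.weight]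
  refine ⟨Finsupp.linearCombination K fun | node d w => ψ d w, ?_⟩
  rintro t ⟨d, w⟩ h
  rw [map_starProd_single]
  simp only [Finsupp.linearCombination_single, one_smul]
  exact (hψ d t w).trans (if_pos h)

theorem exists_map_starProd_eq_of_le (hB : IsNAP mulB) {V : Submodule K (Br K D)}
    (hV : IsGradedComplement V) (f : V →ₗ[K] B) (N : ℕ) :
    ∃ φ : Br K D →ₗ[K] B, (∀ x : V, φ x = f x) ∧
      ∀ t s : PlanarTree D, t.weight + s.weight ≤ N →
        φ (starProd K D (.single t 1) (.single s 1)) =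
          mulB (φ (.single t 1)) (φ (.single s 1)) := by
  induction N with
  | zero =>
    obtain ⟨φ, hφ⟩ := f.exists_extend
    refine ⟨φ, fun x => LinearMap.congr_fun hφ x, fun t s h => ?_⟩
    have := t.weight_pos
    lia
  | succ N ih =>
    obtain ⟨φ, hφf, hφ⟩ := ih
    obtain ⟨ψ, hψ⟩ := exists_map_starProd_eq hB φ hφ
    set P := Submodule.map₂ (starProd K D) ⊤ ⊤
    let q : Br K D →ₗ[K] Br K D := P.subtype ∘ₗ P.projectionOnto V hV.2
    have hqV : ∀ x ∈ V, q x = 0 := fun x hx => by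
      
      change ((P.projectionOnto V hV.2 x : P) : Br K D) = 0
      rw [(Submodule.projectionOnto_apply_eq_zero_iff hV.2).2 hx, Submodule.coe_zero]
    have hqP : ∀ x ∈ P, q x = x := fun x hx => by
      have := Submodule.projectionOnto_apply_left hV.2 ⟨x, hx⟩
      exact congrArg Subtype.val this
    -- `φ` is replaced by `ψ` only on products of weight `N + 1`; as `V` is graded, the correction
    -- vanishes on it.
    let φ' := φ + (ψ - φ) ∘ₗ q ∘ₗ homogComponent K D (N + 1)
    have hφ' : ∀ t : PlanarTree D, t.weight ≠ N + 1 → φ' (.single t 1) = φ (.single t 1) := by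
      intro t ht
      simp [φ', homogComponent_single, ht]
    refine ⟨φ', fun x => ?_, fun t s hts => ?_⟩
    · have : q (homogComponent K D (N + 1) x) = 0 := hqV _ (hV.1 x x.2 _)
      simp [φ', this, hφf]
    · have := t.weight_pos
      have := s.weight_pos
      rw [hφ' t (by lia), hφ' s (by lia)]
      obtain h | h := hts.lt_or_eq
      · rw [← hφ t s (by lia)]
        simp [φ', homogComponent_starProd_single, h.ne]
      · rw [← hψ t s h]
        simp [φ', homogComponent_starProd_single, h, hqP _ (starProd_mem_products _ _)]

theorem exists_lift (hB : IsNAP mulB) {V : Submodule K (Br K D)}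
    (hV : IsGradedComplement V) (f : V →ₗ[K] B) :
    ∃ φ : Br K D →ₗ[K] B, (∀ x y, φ (starProd K D x y) = mulB (φ x) (φ y)) ∧
      ∀ x : V, φ x = f x := by
  choose φ hφf hφ using exists_map_starProd_eq_of_le hB hV f
  have hagree : ∀ {M N : ℕ}, M ≤ N → ∀ t : PlanarTree D, t.weight ≤ M →
      φ M (.single t 1) = φ N (.single t 1) := by
    intro M N hMN t ht
    refine single_mem_of_isGradedComplement (S := LinearMap.eqLocus (φ M) (φ N)) hV
      (fun x hx => (hφf M ⟨x, hx⟩).trans (hφf N ⟨x, hx⟩).symm) (fun r s hrs hr hs => ?_) t ht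
    rw [LinearMap.mem_eqLocus] at *
    rw [hφ M r s hrs, hφ N r s (hrs.trans hMN), hr, hs]
  -- The partial lifts agree in low weights, so each tree may be evaluated by the lift indexed by
  -- its own weight.
  let Φ : Br K D →ₗ[K] B := Finsupp.linearCombination K fun t => φ t.weight (.single t 1)
  have hΦ : ∀ {N : ℕ} {t : PlanarTree D}, t.weight ≤ N → Φ (.single t 1) = φ N (.single t 1) := by
    intro N t h
    rw [← hagree h t le_rfl]
    simp [Φ]
  refine ⟨Φ, map_starProd_eq_of_single Φ mulB ?_, fun x => ?_⟩
  · rintro t ⟨d, w⟩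
    rw [hΦ (Nat.le_add_right _ (node d w).weight), hΦ (Nat.le_add_left _ t.weight),
      ← hφ _ _ _ le_rfl, map_starProd_single, map_starProd_single]
    congr 1
    exact List.map_congr_left fun us hus => hΦ (weight_node_of_mem_permutations'Aux d hus).le
  · rw [← hφf ((x : Br K D).support.sup weight) x]
    generalize hN : (x : Br K D).support.sup weight = N
    rw [← Finsupp.sum_single (x : Br K D), map_finsuppSum, map_finsuppSum]
    refine Finset.sum_congr rfl fun t ht => ?_
    dsimp only
    rw [← mul_one ((x : Br K D) t), ← smul_eq_mul, ← Finsupp.smul_single, map_smul, map_smul,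
      hΦ (hN ▸ Finset.le_sup ht)]

theorem isFreeNAPOn_of_isGradedComplement {V : Submodule K (Br K D)} (hV : IsGradedComplement V)
    {ι : Type z} (b : Module.Basis ι K V) :
    IsFreeNAPOn.{u, max u v, z, t} (starProd K D) fun i => (b i : Br K D) := by
  refine ⟨isNAP_starProd, fun B _ _ mulB hB f => ?_⟩
  obtain ⟨φ, hmul, hφ⟩ := exists_lift hB hV (b.constr K f)
  refine ⟨φ, ⟨hmul, fun i => by rw [hφ, b.constr_basis]⟩, ?_⟩
  rintro χ ⟨hχmul, hχ⟩
  refine LinearMap.eqLocus_eq_top.1 (generates_of_isGradedComplement hV _ ?_ ?_)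
  · intro x hx
    have : χ ∘ₗ V.subtype = φ ∘ₗ V.subtype := b.ext fun i => by
      simp [hχ, hφ, b.constr_basis]
    exact LinearMap.congr_fun this ⟨x, hx⟩
  · intro x hx y hy
    rw [LinearMap.mem_eqLocus] at *
    rw [hχmul, hmul, hx, hy]

end Lift

end BraceNAP

theorem theorem8 (K : Type u) [Field K] [CharZero K] (D : Type v) [Finite D] :
    BraceNAP.IsNAP (BraceNAP.starProd K D) ∧
    (∃ V : Submodule K (BraceNAP.Br K D), BraceNAP.IsGradedComplement V) ∧
    ∀ V : Submodule K (BraceNAP.Br K D), BraceNAP.IsGradedComplement V →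
      BraceNAP.Generates (BraceNAP.starProd K D) V ∧
      ∀ (ι : Type z) (b : Module.Basis ι K V),
        BraceNAP.IsFreeNAPOn.{u, max u v, z, t} (BraceNAP.starProd K D)
          (fun i => (b i : BraceNAP.Br K D)) :=
  ⟨BraceNAP.isNAP_starProd, BraceNAP.exists_isGradedComplement, fun _ hV =>
    ⟨BraceNAP.generates_of_isGradedComplement hV, fun _ b =>
      BraceNAP.isFreeNAPOn_of_isGradedComplement hV b⟩⟩
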